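/- Let $(R,\mathfrak m)$ be a Noetherian local ring and let $M$ be a finite (that is, finitely generated) nonzero $R$-module with $\dim M=d$. Let $x_1,\dots,x_d\in\mathfrak m$ be a system of parameters for $M$, i.e. $d=\dim M$ and $M/(x_1,\dots,x_d)M$ has finite length, and let $J=(x_1,\dots,x_d)$. For an $R$-module $N$ let $\lambda(N)$ denote its length. Then there is a (necessarily unique) polynomial $P_J(M,X)\in\mathbb Q[X]$ such that $\lambda(M/J^{n+1}M)$ is finite and equal to $P_J(M,n)$ for all large integers $n$. It has degree $d$ and can be written (uniquely) in the form $$P_J(M,X)=\sum_{i=0}^{d}(-1)^i\,e_i(J,M)\binom{X+d-i}{d-i}$$ with integers $e_i(J,M)$; put $e_i(J,M)=0$ for $i>d$. The Chern number $e_1(J,M)$ of $J$ with respect to $M$ satisfies $$e_1(J,M)\le 0 .$$ -/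

import Mathlib

open Polynomial

/-- `x` is a system of parameters for the module `M` over the local ring `R`: it consists of
`dim M` elements of the maximal ideal, and `M / (x) M` has finite length. -/
structure IsSystemOfParameters (R : Type*) [CommRing R] [IsLocalRing R]
    (M : Type*) [AddCommGroup M] [Module R M] {d : ℕ} (x : Fin d → R) : Prop where
  dim_eq : Module.supportDim R M = d
  mem_maximalIdeal : ∀ i, x i ∈ IsLocalRing.maximalIdeal R
  length_ne_top :
    Module.length R (M ⧸ (Ideal.span (Set.range x) • ⊤ : Submodule R M)) ≠ ⊤

/-- `P` is the polynomial associated to the function `n ↦ λ(M / I ^ (n + 1) M)`: for all large `n`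
the length of `M / I ^ (n + 1) M` is finite and equal to `P(n)`. -/
def IsHilbertPolynomial {R : Type*} [CommRing R] (I : Ideal R)
    (M : Type*) [AddCommGroup M] [Module R M] (P : ℚ[X]) : Prop :=
  ∀ᶠ n : ℕ in Filter.atTop, ∃ l : ℕ,
    Module.length R (M ⧸ (I ^ (n + 1) • ⊤ : Submodule R M)) = l ∧ P.eval (n : ℚ) = l

/-- There is at most one polynomial associated to `n ↦ λ(M / I ^ (n + 1) M)`. -/
theorem IsHilbertPolynomial.unique {R : Type*} [CommRing R] {I : Ideal R}
    {M : Type*} [AddCommGroup M] [Module R M] {P Q : ℚ[X]}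
    (hP : IsHilbertPolynomial I M P) (hQ : IsHilbertPolynomial I M Q) : P = Q := by
  obtain ⟨N, hN⟩ := Filter.eventually_atTop.1 (hP.and hQ)
  refine Polynomial.eq_of_infinite_eval_eq P Q ?_
  refine ((Set.Ici_infinite N).image (Nat.cast_injective (R := ℚ)).injOn).mono ?_
  rintro _ ⟨n, hn, rfl⟩
  obtain ⟨⟨l, h1, h2⟩, ⟨m, h3, h4⟩⟩ := hN n hn
  have : l = m := by
    rw [h1] at h3
    exact_mod_cast h3
  simp [h2, h4, this]

/-- The Hilbert polynomial `P_I(M, X)` (meaningful when it exists). -/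
noncomputable def hilbertPolynomial {R : Type*} [CommRing R] (I : Ideal R)
    (M : Type*) [AddCommGroup M] [Module R M] : ℚ[X] :=
  Classical.epsilon fun P => IsHilbertPolynomial I M P

/-- The polynomial `binom (X + k) k = (X + k) (X + k - 1) ⋯ (X + 1) / k !`. -/
noncomputable def binomPoly (k : ℕ) : ℚ[X] :=
  (k.factorial : ℚ)⁻¹ • (ascPochhammer ℚ k).comp (X + 1)

theorem binomPoly_eq_preHilbertPoly (k : ℕ) : binomPoly k = preHilbertPoly ℚ k 0 := by
  simp [binomPoly, preHilbertPoly]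

theorem binomPoly_eval (k n : ℕ) : (binomPoly k).eval (n : ℚ) = (n + k).choose k := by
  rw [binomPoly_eq_preHilbertPoly, preHilbertPoly_eq_choose_sub_add ℚ k n.zero_le, Nat.sub_zero]

/-- With `d = deg P`, the integers `e 0, …, e d` are the Hilbert coefficients of `P`:
`P = ∑ i ≤ d, (-1) ^ i * e i * binom (X + d - i) (d - i)`. By convention `e i = 0` for `i > d`. -/
def IsHilbertCoeffs (P : ℚ[X]) (e : ℕ → ℤ) : Prop :=
  P = ∑ i ∈ Finset.range (P.natDegree + 1),
      C ((-1 : ℚ) ^ i * (e i : ℚ)) * binomPoly (P.natDegree - i) ∧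
    ∀ i, P.natDegree < i → e i = 0

/-- The Hilbert coefficients of a polynomial are unique. -/
theorem IsHilbertCoeffs.unique {P : ℚ[X]} {e f : ℕ → ℤ}
    (he : IsHilbertCoeffs P e) (hf : IsHilbertCoeffs P f) : e = f := by
  obtain ⟨he, he0⟩ := he
  obtain ⟨hf, hf0⟩ := hf
  funext i
  induction i using Nat.strong_induction_on with
  | _ i ih =>
    rcases lt_or_ge P.natDegree i with hi | hi
    · rw [he0 i hi, hf0 i hi]
    generalize P.natDegree = d at *
    have key := congrArg (fun Q : ℚ[X] => Q.coeff (d - i)) (he.symm.trans hf)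
    simp only [finsetSum_coeff, coeff_C_mul] at key
    have hne : (binomPoly (d - i)).coeff (d - i) ≠ 0 := by
      rw [binomPoly_eq_preHilbertPoly, coeff_preHilbertPoly_self]
      positivity
    rw [← sub_eq_zero, ← Finset.sum_sub_distrib, Finset.sum_eq_single i] at key
    · rw [← sub_mul, ← mul_sub] at key
      have : ((e i : ℚ) - f i) = 0 := by simpa [hne] using key
      exact_mod_cast sub_eq_zero.1 this
    · intro j hj hji
      rcases lt_or_gt_of_ne hji with h | h
      · rw [ih j h, sub_self]
      · have : (binomPoly (d - j)).coeff (d - i) = 0 := by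
          apply coeff_eq_zero_of_natDegree_lt
          rw [binomPoly_eq_preHilbertPoly, natDegree_preHilbertPoly]
          have := Finset.mem_range.1 hj
          omega
        simp [this]
    · intro h
      exact absurd (Finset.mem_range.2 (by omega)) h

/-- The Hilbert coefficient `e_i(P)` of a polynomial `P`. -/
noncomputable def hilbertCoeff (P : ℚ[X]) (i : ℕ) : ℤ :=
  (Classical.epsilon fun e : ℕ → ℤ => IsHilbertCoeffs P e) i

/-- The Chern number `e_1(I, M) = e_1(P_I(M, X))` of the ideal `I` with respect to `M`. -/
noncomputable def chernNumber {R : Type*} [CommRing R] (I : Ideal R)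
    (M : Type*) [AddCommGroup M] [Module R M] : ℤ :=
  hilbertCoeff (hilbertPolynomial I M) 1

/-! Refine JM ⊂ M to a finite chain in which each step passes from B to B + Rv with 𝔪v ⊂ B. Then
J^n(B + Rv)/J^nB is a residue field vector space spanned by the classes of x^α v with |α| = n. Its
dimension is the number of such α outside the set of lexicographically leading exponents of
relations, and that set is an upper set of ℕ^d, as for initial ideals
(`isUpperSet_leadingExponents`). Summing over the chain and over degrees, λ(M/J^{n+1}M) is a finite
sum of counts #{α ∉ U : |α| ≤ n} (`exists_upperSets_length`).

Expand each count, for large n, as ∑ a_j binom(n+j, j) with j ≤ d. If U is empty the count is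
binom(n+d, d), so a_{d-1} = 0. If U is nonempty then a_d = 0, and since the count is nonnegative,
a_{d-1} ≥ 0 (`exists_isNumerical_card_notMem`). Hence e_1 = -a_{d-1} ≤ 0 for d > 0.

The coefficient a_{d-1} gives e_1 only when the polynomial has degree exactly d. The degree is at
most d by the expansion, and at least dim M by Artin–Rees applied along chains of primes
(`supportDim_le_natDegree`). -/

section Length

/-! ### Lengths and socle elements -/

variable {R : Type*} [CommRing R] {M : Type*} [AddCommGroup M] [Module R M]

/-- The length of `M ⧸ p` splits along an intermediate submodule. -/
theorem length_quotient_eq_length_quotient_sup_add {p q : Submodule R M} (h : p ≤ q) :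
    Module.length R (M ⧸ p) =
      Module.length R (M ⧸ q) + Module.length R (q.map p.mkQ) := by
  rw [add_comm, Module.length_eq_add_of_exact (q.map p.mkQ).subtype (q.map p.mkQ).mkQ
    (Submodule.subtype_injective _) (Submodule.mkQ_surjective _)
    (LinearMap.exact_subtype_mkQ _),
    (Submodule.quotientQuotientEquivQuotient p q h).length_eq]

theorem length_quotient_anti {p q : Submodule R M} (h : p ≤ q) :
    Module.length R (M ⧸ q) ≤ Module.length R (M ⧸ p) := by
  rw [length_quotient_eq_length_quotient_sup_add h]
  exact le_self_add

theorem length_map_mkQ_span_singleton [IsLocalRing R] {p : Submodule R M} {v : M} (hv : v ∉ p)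
    (hm : ∀ a ∈ IsLocalRing.maximalIdeal R, a • v ∈ p) :
    Module.length R ((p ⊔ R ∙ v).map p.mkQ) = 1 := by
  have hmap : (p ⊔ R ∙ v).map p.mkQ = R ∙ p.mkQ v := by
    rw [Submodule.map_sup, Submodule.map_span, Set.image_singleton]
    simp
  have hne : p.mkQ v ≠ 0 := by simpa using hv
  rw [hmap, Module.length_eq_one_iff, isSimpleModule_iff_isAtom]
  refine ⟨by simpa using hne, fun q hq => ?_⟩
  by_contra hbot
  obtain ⟨w, hw, hw0⟩ := Submodule.exists_mem_ne_zero_of_ne_bot hbot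
  obtain ⟨a, rfl⟩ := Submodule.mem_span_singleton.1 (hq.le hw)
  refine hq.not_ge ((Submodule.span_singleton_le_iff_mem _ _).2 ?_)
  by_cases ha : a ∈ IsLocalRing.maximalIdeal R
  · exact absurd ((Submodule.Quotient.mk_eq_zero p).2 (hm a ha)) hw0
  · have hu : IsUnit a := by simpa using ha
    exact (Submodule.smul_mem_iff_of_isUnit q hu).1 hw

theorem length_quotient_eq_add_one [IsLocalRing R] {p : Submodule R M} {v : M} (hv : v ∉ p)
    (hm : ∀ a ∈ IsLocalRing.maximalIdeal R, a • v ∈ p) :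
    Module.length R (M ⧸ p) = Module.length R (M ⧸ (p ⊔ R ∙ v)) + 1 := by
  rw [length_quotient_eq_length_quotient_sup_add (le_sup_left : p ≤ p ⊔ R ∙ v),
    length_map_mkQ_span_singleton hv hm]

open Classical in
/-- Adjoining socle elements one after the other: the length drops by one at each element
which is not in the span of the previous ones. -/
theorem length_quotient_eq_length_quotient_span_add_card [IsLocalRing R]
    {ι : Type*} [LinearOrder ι] (p : Submodule R M) (v : ι → M)
    (s : Finset ι) (hm : ∀ i ∈ s, ∀ a ∈ IsLocalRing.maximalIdeal R, a • v i ∈ p) :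
    Module.length R (M ⧸ p) = Module.length R (M ⧸ (p ⊔ Submodule.span R (v '' s))) +
      (s.filter fun i => v i ∉ p ⊔ Submodule.span R (v '' {j ∈ s | j < i})).card := by
  -- Inserting a new maximum leaves the set of predecessors of every earlier index unchanged.
  induction s using Finset.induction_on_max with
  | empty =>
    have : p ⊔ Submodule.span R (v '' ↑(∅ : Finset ι)) = p := by simp
    rw [this]
    simp
  | insert i s his ih =>
    have hnot : i ∉ s := fun h => lt_irrefl _ (his i h)
    rw [ih fun j hj => hm j (Finset.mem_insert_of_mem hj), Finset.filter_insert]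
    have h1 : {j | j ∈ insert i s ∧ j < i} = (s : Set ι) := by
      ext j
      simp only [Finset.mem_insert, Set.mem_ofPred_eq, Finset.mem_coe]
      constructor
      · rintro ⟨rfl | h, h'⟩
        · exact absurd h' (lt_irrefl _)
        · exact h
      · exact fun h => ⟨.inr h, his j h⟩
    have h2 : ∀ j ∈ s, {k | k ∈ insert i s ∧ k < j} = {k | k ∈ s ∧ k < j} := by
      intro j hj
      ext k
      simp only [Finset.mem_insert, Set.mem_ofPred_eq]
      constructor
      · rintro ⟨rfl | h, h'⟩
        · exact absurd h' (his j hj).not_gt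
        · exact ⟨h, h'⟩
      · exact fun h => ⟨.inr h.1, h.2⟩
    have h3 : (s.filter fun j => v j ∉ p ⊔ Submodule.span R (v '' {k | k ∈ insert i s ∧ k < j})) =
        s.filter fun j => v j ∉ p ⊔ Submodule.span R (v '' {k | k ∈ s ∧ k < j}) :=
      Finset.filter_congr fun j hj => by rw [h2 j hj]
    have h4 : p ⊔ Submodule.span R (v '' ↑(insert i s)) =
        p ⊔ Submodule.span R (v '' s) ⊔ R ∙ v i := by
      rw [Finset.coe_insert, Set.image_insert_eq, Submodule.span_insert, sup_comm (R ∙ v i),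
        sup_assoc]
    rw [h1, h3, h4]
    split_ifs with h
    · rw [sup_eq_left.2 ((Submodule.span_singleton_le_iff_mem _ _).2 h)]
    · rw [length_quotient_eq_add_one h fun a ha =>
        Submodule.mem_sup_left (hm i (Finset.mem_insert_self _ _) a ha),
        Finset.card_insert_of_notMem (by simp [hnot])]
      push_cast
      rw [add_assoc, add_comm (1 : ℕ∞)]

/-- A nonzero module of finite length contains a simple submodule, whose annihilator is the maximal
ideal. -/
theorem exists_socle_element [IsLocalRing R] {p : Submodule R M}
    (hp : Module.length R (M ⧸ p) ≠ ⊤) (hne : p ≠ ⊤) :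
    ∃ v ∉ p, ∀ a ∈ IsLocalRing.maximalIdeal R, a • v ∈ p := by
  obtain ⟨_, _⟩ := isFiniteLength_iff_isNoetherian_isArtinian.1 (Module.length_ne_top_iff.1 hp)
  have : Nontrivial (M ⧸ p) := Submodule.Quotient.nontrivial_iff.2 hne
  obtain ⟨S, hS, -⟩ := IsAtomic.eq_bot_or_exists_atom_le (⊤ : Submodule R (M ⧸ p)) |>.resolve_left
    top_ne_bot
  have hsimple : IsSimpleModule R S := isSimpleModule_iff_isAtom.2 hS
  obtain ⟨w, hw, hw0⟩ := Submodule.exists_mem_ne_zero_of_ne_bot hS.1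
  obtain ⟨v, rfl⟩ := p.mkQ_surjective w
  refine ⟨v, by simpa using hw0, fun a ha => ?_⟩
  rw [← IsLocalRing.eq_maximalIdeal (IsSimpleModule.annihilator_isMaximal (R := R) (M := S))] at ha
  have := Module.mem_annihilator.1 ha ⟨_, hw⟩
  rw [← Submodule.Quotient.mk_eq_zero]
  simpa using congrArg Subtype.val this

end Length

/-! ### Monomials, leading exponents and the Hilbert–Samuel function -/

section Monomials

/-- The finite set of exponents of degree at most `n`. -/
def degLE (d n : ℕ) : Finset (Fin d → ℕ) :=
  (Fintype.piFinset fun _ => Finset.range (n + 1)).filter fun α => ∑ i, α i ≤ n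

theorem mem_degLE {d n : ℕ} {α : Fin d → ℕ} : α ∈ degLE d n ↔ ∑ i, α i ≤ n := by
  simp only [degLE, Finset.mem_filter, Fintype.mem_piFinset, Finset.mem_range, and_iff_right_iff_imp]
  intro h i
  exact Nat.lt_succ_of_le ((Finset.single_le_sum (fun j _ => (α j).zero_le)
    (Finset.mem_univ i)).trans h)

/-- The finite set of exponents of degree `n`. -/
def degEQ (d n : ℕ) : Finset (Fin d → ℕ) := Finset.piAntidiag Finset.univ n

theorem mem_degEQ {d n : ℕ} {α : Fin d → ℕ} : α ∈ degEQ d n ↔ ∑ i, α i = n := by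
  simp [degEQ]

theorem degLE_zero (d : ℕ) : degLE d 0 = degEQ d 0 := by
  ext α
  simp [mem_degLE, mem_degEQ]

theorem degLE_succ (d n : ℕ) : degLE d (n + 1) = degLE d n ∪ degEQ d (n + 1) := by
  ext α
  simp [mem_degLE, mem_degEQ, Nat.le_succ_iff]

theorem disjoint_degLE_degEQ (d n : ℕ) : Disjoint (degLE d n) (degEQ d (n + 1)) := by
  rw [Finset.disjoint_left]
  intro α h1 h2
  rw [mem_degLE] at h1
  rw [mem_degEQ] at h2
  omega

theorem card_filter_degLE_succ (d n : ℕ) (P : (Fin d → ℕ) → Prop) [DecidablePred P] :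
    ((degLE d (n + 1)).filter P).card =
      ((degLE d n).filter P).card + ((degEQ d (n + 1)).filter P).card := by
  rw [degLE_succ, Finset.filter_union, Finset.card_union_of_disjoint]
  exact Finset.disjoint_filter_filter (disjoint_degLE_degEQ d n)

variable {R : Type*} [CommRing R] {M : Type*} [AddCommGroup M] [Module R M] {d : ℕ}

/-- The monomial `x ^ α`. -/
def monom (x : Fin d → R) (α : Fin d → ℕ) : R := ∏ i, x i ^ α i

theorem monom_add (x : Fin d → R) (α β : Fin d → ℕ) :
    monom x (α + β) = monom x α * monom x β := by
  simp [monom, pow_add, Finset.prod_mul_distrib]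

theorem monom_mem_pow (x : Fin d → R) (α : Fin d → ℕ) :
    monom x α ∈ Ideal.span (Set.range x) ^ ∑ i, α i := by
  rw [monom, ← Finset.prod_pow_eq_pow_sum]
  exact Ideal.prod_mem_prod fun i _ =>
    Ideal.pow_mem_pow (Ideal.subset_span (Set.mem_range_self i)) _

theorem span_range_pow_eq_span_monom (x : Fin d → R) (n : ℕ) :
    Ideal.span (Set.range x) ^ n = Ideal.span (monom x '' degEQ d n) := by
  apply le_antisymm
  · intro y hy
    obtain ⟨p, hp, rfl⟩ := (Ideal.mem_span_pow_iff_exists_isHomogeneous x y).1 hy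
    rw [MvPolynomial.eval_eq']
    refine Ideal.sum_mem _ fun α hα => Ideal.mul_mem_left _ _ (Ideal.subset_span ⟨α, ?_, rfl⟩)
    have := hp (MvPolynomial.mem_support_iff.1 hα)
    rw [Finset.mem_coe, mem_degEQ, ← this, Finsupp.weight_apply, Finsupp.sum_fintype] <;> simp
  · rw [Ideal.span_le]
    rintro _ ⟨α, hα, rfl⟩
    have := monom_mem_pow x α
    rwa [mem_degEQ.1 hα] at this

theorem span_range_pow_smul_span_singleton (x : Fin d → R) (n : ℕ) (v : M) :
    Ideal.span (Set.range x) ^ n • (R ∙ v) =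
      Submodule.span R ((fun α => monom x α • v) '' degEQ d n) := by
  rw [span_range_pow_eq_span_monom, Ideal.span, Submodule.span_smul_span]
  congr 1
  ext w
  simp

/-- The exponents of the leading monomials of the forms `F` with `F v ∈ J ^ (deg F) B`. -/
def leadingExponents (x : Fin d → R) (B : Submodule R M) (v : M) : Set (Fin d → ℕ) :=
  {α | monom x α • v ∈ Ideal.span (Set.range x) ^ (∑ i, α i) • B ⊔
    Submodule.span R ((fun β => monom x β • v) ''
      {β | ∑ i, β i = ∑ i, α i ∧ toLex β < toLex α})}

theorem mem_leadingExponents {x : Fin d → R} {B : Submodule R M} {v : M} {α : Fin d → ℕ} :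
    α ∈ leadingExponents x B v ↔
      monom x α • v ∈ Ideal.span (Set.range x) ^ (∑ i, α i) • B ⊔
        Submodule.span R ((fun β => monom x β • v) ''
          {β | ∑ i, β i = ∑ i, α i ∧ toLex β < toLex α}) :=
  Iff.rfl

/-- Multiplying a relation by x^γ raises its degree by |γ| and preserves the lexicographic order of
its terms. -/
theorem isUpperSet_leadingExponents (x : Fin d → R) (B : Submodule R M) (v : M) :
    IsUpperSet (leadingExponents x B v) := by
  intro α α' hle hα
  obtain ⟨γ, rfl⟩ : ∃ γ, α' = γ + α := ⟨α' - α, (tsub_add_cancel_of_le hle).symm⟩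
  rw [mem_leadingExponents] at hα ⊢
  have key := Submodule.smul_mem_pointwise_smul _ (monom x γ) _ hα
  rw [smul_smul, ← monom_add, Submodule.smul_sup'] at key
  refine SetLike.le_def.1 (sup_le_sup ?_ ?_) key
  · rintro _ ⟨w, hw, rfl⟩
    have hsum : ∑ i, (γ + α) i = ∑ i, γ i + ∑ i, α i := by
      simp [Finset.sum_add_distrib]
    rw [hsum, pow_add, Submodule.mul_smul]
    exact Submodule.smul_mem_smul (monom_mem_pow x γ) hw
  · rw [Submodule.smul_span]
    apply Submodule.span_mono
    rintro _ ⟨_, ⟨β, ⟨h1, h2⟩, rfl⟩, rfl⟩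
    refine ⟨γ + β, ⟨?_, ?_⟩, ?_⟩
    · simp [Finset.sum_add_distrib, h1]
    · rw [toLex_add, toLex_add]
      exact add_lt_add_right h2 _
    · simp [monom_add, smul_smul]

-- The vectors x^α v with |α| = n are killed by 𝔪 modulo J^n B, so they can be adjoined in
-- lexicographic order; the length drops exactly at the non-leading exponents.
open Classical in
theorem length_quotient_pow_smul_eq_add_card [IsLocalRing R] (x : Fin d → R) (B : Submodule R M)
    (v : M) (hv : ∀ a ∈ IsLocalRing.maximalIdeal R, a • v ∈ B) (n : ℕ) :
    Module.length R (M ⧸ (Ideal.span (Set.range x) ^ n • B)) =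
      Module.length R (M ⧸ (Ideal.span (Set.range x) ^ n • (B ⊔ R ∙ v))) +
        ((degEQ d n).filter (· ∉ leadingExponents x B v)).card := by
  have h := length_quotient_eq_length_quotient_span_add_card (ι := Lex (Fin d → ℕ))
    (Ideal.span (Set.range x) ^ n • B) (fun α => monom x (ofLex α) • v)
    ((degEQ d n).map toLex.toEmbedding) ?_
  · have himage : ∀ p : (Fin d → ℕ) → Prop, ∀ q : Lex (Fin d → ℕ) → Prop,
        (∀ β, q (toLex β) ↔ p β) →
        (fun α : Lex (Fin d → ℕ) => monom x (ofLex α) • v) '' {β | q β} =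
          (fun β => monom x β • v) '' {β | p β} := by
      intro p q hpq
      ext w
      constructor
      · rintro ⟨β, hβ, rfl⟩
        exact ⟨ofLex β, (hpq _).1 hβ, rfl⟩
      · rintro ⟨β, hβ, rfl⟩
        exact ⟨toLex β, (hpq _).2 hβ, rfl⟩
    have hspan : (fun α : Lex (Fin d → ℕ) => monom x (ofLex α) • v) ''
        ↑((degEQ d n).map toLex.toEmbedding) = (fun β => monom x β • v) '' ↑(degEQ d n) :=
      himage (· ∈ degEQ d n) (· ∈ (degEQ d n).map toLex.toEmbedding) (by simp)
    rw [h, hspan, Submodule.smul_sup, span_range_pow_smul_span_singleton, Finset.filter_map,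
      Finset.card_map]
    congr 3
    apply Finset.filter_congr
    intro α hα
    rw [mem_degEQ] at hα
    rw [mem_leadingExponents, hα, ← himage (fun β => ∑ i, β i = n ∧ toLex β < toLex α)
      (fun β => β ∈ (degEQ d n).map toLex.toEmbedding ∧ β < toLex α) (by simp [mem_degEQ])]
    rfl
  · simp only [Finset.mem_map, mem_degEQ]
    rintro _ ⟨α, hα, rfl⟩ a ha
    change a • monom x α • v ∈ _
    rw [smul_comm]
    have := monom_mem_pow x α
    rw [hα] at this
    exact Submodule.smul_mem_smul this (hv a ha)

open Classical in
theorem exists_upperSets_length_pow_smul [IsLocalRing R] (x : Fin d → R) (l : ℕ) :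
    ∀ B : Submodule R M, Module.length R (M ⧸ B) = l →
    ∃ s : List (UpperSet (Fin d → ℕ)), ∀ n,
      Module.length R (M ⧸ (Ideal.span (Set.range x) ^ n • B)) =
        Module.length R (M ⧸ (Ideal.span (Set.range x) ^ n • ⊤ : Submodule R M)) +
          ((s.map fun U => ((degEQ d n).filter (· ∉ U)).card).sum : ℕ) := by
  induction l with
  | zero =>
    intro B hB
    have : B = ⊤ := by
      rw [Nat.cast_zero, Module.length_eq_zero_iff] at hB
      exact Submodule.Quotient.subsingleton_iff.1 hB
    exact ⟨[], fun n => by rw [this]; simp⟩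
  | succ l ih =>
    intro B hB
    have hne : B ≠ ⊤ := by
      rintro rfl
      have : Module.length R (M ⧸ (⊤ : Submodule R M)) = 0 := Module.length_eq_zero
      rw [this] at hB
      exact absurd hB.symm (by simp)
    obtain ⟨v, hvB, hv⟩ := exists_socle_element (hB ▸ ENat.natCast_ne_top _) hne
    have hl := length_quotient_eq_add_one hvB hv
    rw [hB, Nat.cast_add, Nat.cast_one] at hl
    obtain ⟨s, hs⟩ := ih _ ((ENat.add_left_injective_of_ne_top ENat.one_ne_top) hl).symm
    refine ⟨⟨_, isUpperSet_leadingExponents x B v⟩ :: s, fun n => ?_⟩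
    rw [length_quotient_pow_smul_eq_add_card x B v hv, hs, List.map_cons, List.sum_cons,
      Nat.cast_add, add_assoc, add_comm (Nat.cast _)]
    rfl

open Classical in
/-- The Hilbert–Samuel function is a finite sum of functions counting the monomials outside of
upper sets. -/
theorem exists_upperSets_length [IsLocalRing R] (x : Fin d → R)
    (h : Module.length R (M ⧸ (Ideal.span (Set.range x) • ⊤ : Submodule R M)) ≠ ⊤) :
    ∃ s : List (UpperSet (Fin d → ℕ)), ∀ n,
      Module.length R (M ⧸ (Ideal.span (Set.range x) ^ (n + 1) • ⊤ : Submodule R M)) =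
          ((s.map fun U => ((degLE d n).filter (· ∉ U)).card).sum : ℕ) := by
  obtain ⟨l, hl⟩ := ENat.ne_top_iff_exists.1 h
  -- With B = JM one has J^n B = J^{n+1}M, so `hs` is a recursion in n whose solution sums the
  -- degree-n counts.
  obtain ⟨s, hs⟩ := exists_upperSets_length_pow_smul x l _ hl.symm
  refine ⟨s, fun n => ?_⟩
  have key := hs n
  rw [← Submodule.mul_smul, ← pow_succ] at key
  induction n with
  | zero =>
    have h0 : Module.length R (M ⧸ (Ideal.span (Set.range x) ^ 0 • ⊤ : Submodule R M)) = 0 := by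
      rw [pow_zero, Ideal.one_eq_top, Submodule.top_smul]
      exact Module.length_eq_zero
    rw [key, h0, zero_add, degLE_zero]
  | succ n ih =>
    have key' := hs n
    rw [← Submodule.mul_smul, ← pow_succ] at key'
    rw [key, ih key', ← Nat.cast_add]
    simp only [card_filter_degLE_succ, List.sum_map_add]

end Monomials

/-! ### Integer combinations of binomial functions -/

section NumericalFunctions

open Filter

/-- Eventually `f n = ∑ j ≤ d, a j * binom (n + j) j`. -/
def IsNumerical (d : ℕ) (f : ℕ → ℤ) (a : ℕ → ℤ) : Prop :=
  ∀ᶠ n in atTop, f n = ∑ j ∈ Finset.range (d + 1), a j * ((n + j).choose j : ℕ)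

theorem IsNumerical.add {d : ℕ} {f g a b : ℕ → ℤ} (hf : IsNumerical d f a)
    (hg : IsNumerical d g b) : IsNumerical d (f + g) (a + b) := by
  filter_upwards [hf, hg] with n h1 h2
  simp [h1, h2, add_mul, Finset.sum_add_distrib]

theorem IsNumerical.sub {d : ℕ} {f g a b : ℕ → ℤ} (hf : IsNumerical d f a)
    (hg : IsNumerical d g b) : IsNumerical d (f - g) (a - b) := by
  filter_upwards [hf, hg] with n h1 h2
  simp [h1, h2, sub_mul, Finset.sum_sub_distrib]

/-- Pascal's rule rewrites the expansion after a shift of the variable by one; the top coefficient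
survives. -/
theorem sum_mul_choose_eq (d m : ℕ) (a : ℕ → ℤ) :
    ∑ j ∈ Finset.range (d + 1), a j * ((m + j).choose j : ℕ) =
      ∑ j ∈ Finset.range (d + 1),
        (if j < d then a j - a (j + 1) else a j) * ((m + 1 + j).choose j : ℕ) := by
  have h1 : ∀ j, (((m + (j + 1)).choose (j + 1) : ℕ) : ℤ) =
      ((m + 1 + (j + 1)).choose (j + 1) : ℕ) - ((m + 1 + j).choose j : ℕ) := by
    intro j
    rw [show m + 1 + (j + 1) = m + (j + 1) + 1 by ring, Nat.choose_succ_succ,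
      show m + 1 + j = m + (j + 1) by ring]
    push_cast
    ring
  have h2 : ∑ j ∈ Finset.range (d + 1), a j * ((m + 1 + j).choose j : ℕ) =
      ∑ j ∈ Finset.range d, a (j + 1) * ((m + 1 + (j + 1)).choose (j + 1) : ℕ) + a 0 := by
    rw [Finset.sum_range_succ']
    simp
  have h3 : ∑ j ∈ Finset.range (d + 1),
      (if j < d then a j - a (j + 1) else a j) * (((m + 1 + j).choose j : ℕ) : ℤ) =
      ∑ j ∈ Finset.range d, (a j - a (j + 1)) * ((m + 1 + j).choose j : ℕ) +
        a d * ((m + 1 + d).choose d : ℕ) := by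
    rw [Finset.sum_range_succ, if_neg (lt_irrefl d)]
    congr 1
    exact Finset.sum_congr rfl fun j hj => by rw [if_pos (Finset.mem_range.1 hj)]
  rw [h3, Finset.sum_range_succ']
  simp only [h1, mul_sub, sub_mul, Finset.sum_sub_distrib]
  rw [Finset.sum_range_succ] at h2
  simp only [Nat.choose_zero_right, Nat.cast_one, mul_one]
  linarith

theorem IsNumerical.comp_sub {d : ℕ} {f a : ℕ → ℤ} (hf : IsNumerical d f a) (s : ℕ) :
    ∃ b, b d = a d ∧ IsNumerical d (fun n => f (n - s)) b := by
  induction s with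
  | zero => exact ⟨a, rfl, hf⟩
  | succ s ih =>
    obtain ⟨b, hb, h⟩ := ih
    refine ⟨fun j => if j < d then b j - b (j + 1) else b j, by simpa using hb, ?_⟩
    obtain ⟨N, hN⟩ := eventually_atTop.1 h
    refine eventually_atTop.2 ⟨N + 1, fun n hn => ?_⟩
    obtain ⟨m, rfl⟩ : ∃ m, n = m + 1 := ⟨n - 1, by omega⟩
    have := hN m (by omega)
    dsimp only at this ⊢
    rw [show m + 1 - (s + 1) = m - s by omega, ← sum_mul_choose_eq, ← this]

/-- The polynomial with coefficients `a 0, …, a d` in the basis `binomPoly`. -/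
noncomputable def numericalPoly (d : ℕ) (a : ℕ → ℤ) : ℚ[X] :=
  ∑ j ∈ Finset.range (d + 1), C (a j : ℚ) * binomPoly j

theorem numericalPoly_eval (d : ℕ) (a : ℕ → ℤ) (n : ℕ) :
    (numericalPoly d a).eval (n : ℚ) =
      ((∑ j ∈ Finset.range (d + 1), a j * ((n + j).choose j : ℕ) : ℤ) : ℚ) := by
  simp [numericalPoly, eval_finsetSum, binomPoly_eval]

theorem natDegree_binomPoly (k : ℕ) : (binomPoly k).natDegree = k := by
  rw [binomPoly_eq_preHilbertPoly, natDegree_preHilbertPoly]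

theorem coeff_binomPoly_pos (k : ℕ) : 0 < (binomPoly k).coeff k := by
  rw [binomPoly_eq_preHilbertPoly, coeff_preHilbertPoly_self]
  positivity

theorem natDegree_numericalPoly_le (d : ℕ) (a : ℕ → ℤ) : (numericalPoly d a).natDegree ≤ d := by
  refine natDegree_sum_le_of_forall_le _ _ fun j hj => ?_
  refine (natDegree_C_mul_le _ _).trans ?_
  rw [natDegree_binomPoly]
  exact Nat.le_of_lt_succ (Finset.mem_range.1 hj)

theorem coeff_numericalPoly (d : ℕ) (a : ℕ → ℤ) :
    (numericalPoly d a).coeff d = a d * (binomPoly d).coeff d := by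
  rw [numericalPoly, finsetSum_coeff, Finset.sum_eq_single d]
  · simp
  · intro j hj hjd
    rw [coeff_C_mul, coeff_eq_zero_of_natDegree_lt, mul_zero]
    have := Finset.mem_range.1 hj
    rw [natDegree_binomPoly]
    omega
  · simp

theorem leadingCoeff_nonneg_of_eventually {P : ℚ[X]} (h : ∀ᶠ n : ℕ in atTop, 0 ≤ P.eval (n : ℚ)) :
    0 ≤ P.leadingCoeff := by
  by_contra! hlt
  by_cases hdeg : 0 < P.degree
  · have h1 := (P.tendsto_atBot_of_leadingCoeff_nonpos hdeg hlt.le).comp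
      tendsto_natCast_atTop_atTop
    obtain ⟨n, h2, h3⟩ := (h.and (h1.eventually_lt_atBot 0)).exists
    exact absurd h2 (not_le.2 h3)
  · rw [eq_C_of_degree_le_zero (not_lt.1 hdeg)] at h hlt
    obtain ⟨n, hn⟩ := h.exists
    simp only [eval_C, leadingCoeff_C] at hn hlt
    exact absurd hn (not_le.2 hlt)

theorem natDegree_le_of_eventually_le {P Q : ℚ[X]}
    (h0 : ∀ᶠ n : ℕ in atTop, 0 ≤ P.eval (n : ℚ))
    (h : ∀ᶠ n : ℕ in atTop, P.eval (n : ℚ) ≤ Q.eval (n : ℚ)) : P.natDegree ≤ Q.natDegree := by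
  by_contra! hlt
  have hP : P ≠ 0 := by
    rintro rfl
    simp at hlt
  have h1 : 0 ≤ (Q - P).leadingCoeff :=
    leadingCoeff_nonneg_of_eventually (h.mono fun n hn => by simpa using hn)
  have h2 : (Q - P).leadingCoeff = -P.leadingCoeff := by
    rw [← neg_sub, leadingCoeff_neg, leadingCoeff_sub_of_degree_lt (degree_lt_degree hlt)]
  have h3 := (leadingCoeff_nonneg_of_eventually h0).lt_of_ne' (leadingCoeff_ne_zero.2 hP)
  linarith

end NumericalFunctions

/-! ### Counting exponents outside an upper set -/

section Counting

open Filter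

theorem card_degEQ (d n : ℕ) : (degEQ d n).card = d.multichoose n := by
  have h : degEQ d n = (Finset.finsuppAntidiag Finset.univ n).map
      (Finsupp.equivFunOnFinite : (Fin d →₀ ℕ) ≃ (Fin d → ℕ)).toEmbedding := by
    ext α
    simp only [mem_degEQ, Finset.mem_map, Finset.mem_finsuppAntidiag]
    constructor
    · intro h
      exact ⟨Finsupp.equivFunOnFinite.symm α, ⟨by simpa using h, by simp⟩, by simp⟩
    · rintro ⟨β, ⟨h, -⟩, rfl⟩
      simpa using h
  rw [h, Finset.card_map, Finset.card_finsuppAntidiag_nat_eq_multichoose, Finset.card_univ,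
    Fintype.card_fin]

theorem card_degLE (d n : ℕ) : (degLE d n).card = (n + d).choose d := by
  induction n with
  | zero => simp [degLE_zero, card_degEQ]
  | succ n ih =>
    rw [degLE_succ, Finset.card_union_of_disjoint (disjoint_degLE_degEQ d n), ih, card_degEQ,
      Nat.multichoose_eq]
    cases d with
    | zero => simp
    | succ d =>
      rw [show n + 1 + (d + 1) = n + (d + 1) + 1 by ring, Nat.choose_succ_succ,
        show d + 1 + (n + 1) - 1 = n + (d + 1) by omega, add_comm]
      congr 1
      rw [← Nat.choose_symm_of_eq_add]
      ring

open Classical in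
/-- The number of exponents of degree at most `n` which are not above an element of `A`. -/
noncomputable def countNotAbove (d : ℕ) (A : List (Fin d → ℕ)) (n : ℕ) : ℕ :=
  ((degLE d n).filter fun α => ∀ a ∈ A, ¬ a ≤ α).card

-- Inclusion–exclusion: the exponents above γ that avoid A are the translates by γ of those avoiding
-- A - γ. Truncated subtraction is the right one, since a ≤ α + γ iff a - γ ≤ α.
open Classical in
theorem countNotAbove_cons {d : ℕ} (γ : Fin d → ℕ) (A : List (Fin d → ℕ)) {n : ℕ}
    (hn : ∑ i, γ i ≤ n) :
    countNotAbove d (γ :: A) n + countNotAbove d (A.map (· - γ)) (n - ∑ i, γ i) =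
      countNotAbove d A n := by
  have h1 : countNotAbove d (A.map (· - γ)) (n - ∑ i, γ i) =
      (((degLE d n).filter fun α => ∀ a ∈ A, ¬ a ≤ α).filter fun α => ¬ ¬ γ ≤ α).card := by
    refine Finset.card_bij' (fun α _ => α + γ) (fun α _ => α - γ) ?_ ?_ ?_ ?_
    · intro α hα
      simp only [Finset.mem_filter, mem_degLE, List.forall_mem_map, tsub_le_iff_right,
        not_not] at hα ⊢
      refine ⟨⟨?_, hα.2⟩, le_add_self⟩
      simp only [Pi.add_apply, Finset.sum_add_distrib]
      omega
    · intro α hα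
      simp only [Finset.mem_filter, mem_degLE, List.forall_mem_map, tsub_le_iff_right,
        not_not] at hα ⊢
      rw [tsub_add_cancel_of_le hα.2]
      refine ⟨?_, hα.1.2⟩
      have : ∑ i, (α - γ) i + ∑ i, γ i = ∑ i, α i := by
        rw [← Finset.sum_add_distrib]
        exact Finset.sum_congr rfl fun i _ => tsub_add_cancel_of_le (hα.2 i)
      omega
    · intro α _
      exact add_tsub_cancel_right α γ
    · intro α hα
      simp only [Finset.mem_filter, not_not] at hα
      exact tsub_add_cancel_of_le hα.2
  have h2 : countNotAbove d (γ :: A) n =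
      (((degLE d n).filter fun α => ∀ a ∈ A, ¬ a ≤ α).filter fun α => ¬ γ ≤ α).card := by
    rw [countNotAbove, Finset.filter_filter]
    congr 1
    apply Finset.filter_congr
    simp [and_comm]
  rw [h1, h2, countNotAbove, Finset.card_filter_add_card_filter_not]

-- The recursion subtracts a shifted count for a list of equal length, hence the induction on
-- length. Leading coefficients cancel: 1 - 1 when the tail is empty, 0 - 0 otherwise.
open Classical in
theorem exists_isNumerical_countNotAbove (d l : ℕ) : ∀ A : List (Fin d → ℕ), A.length = l →
    ∃ a, IsNumerical d (fun n => countNotAbove d A n) a ∧ a d = if A = [] then 1 else 0 := by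
  induction l with
  | zero =>
    intro A hA
    obtain rfl := List.length_eq_zero_iff.1 hA
    refine ⟨fun j => if j = d then 1 else 0, Eventually.of_forall fun n => ?_, by simp⟩
    simp [countNotAbove, card_degLE]
  | succ l ih =>
    intro A hA
    obtain ⟨γ, A, rfl⟩ := List.exists_cons_of_length_eq_add_one hA
    have hl : A.length = l := by simpa using hA
    obtain ⟨a, ha, had⟩ := ih A hl
    obtain ⟨b, hb, hbd⟩ := ih (A.map (· - γ)) (by simpa using hl)
    obtain ⟨c, hcd, hc⟩ := hb.comp_sub (∑ i, γ i)
    refine ⟨a - c, ?_, ?_⟩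
    · filter_upwards [ha.sub hc, eventually_ge_atTop (∑ i, γ i)] with n h hn
      rw [← h, Pi.sub_apply, ← countNotAbove_cons γ A hn]
      simp
    · simp [had, hcd, hbd]

/-- Dickson's lemma: the minimal elements form an antichain in a well quasi-order. -/
theorem UpperSet.exists_list_mem_iff {d : ℕ} (U : UpperSet (Fin d → ℕ)) :
    ∃ A : List (Fin d → ℕ), ∀ α, α ∈ U ↔ ∃ a ∈ A, a ≤ α := by
  have hfin : {a | Minimal (· ∈ U) a}.Finite :=
    WellQuasiOrderedLE.finite_of_isAntichain (setOfPred_minimal_antichain _)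
  refine ⟨hfin.toFinset.toList, fun α => ⟨fun h => ?_, ?_⟩⟩
  · obtain ⟨b, hb, hmin⟩ := exists_minimal_le_of_wellFoundedLT (· ∈ U) α h
    exact ⟨b, by simpa using hmin, hb⟩
  · rintro ⟨a, ha, hle⟩
    have : Minimal (· ∈ U) a := by simpa using ha
    exact U.upper hle this.prop

-- The sign of e_1 is decided here: a nonempty upper set kills the coefficient of index d, so index
-- d - 1 becomes the top one and inherits the nonnegativity of the count.
open Classical in
theorem exists_isNumerical_card_notMem {d : ℕ} (U : UpperSet (Fin d → ℕ)) :
    ∃ a, IsNumerical d (fun n => ((degLE d n).filter (· ∉ U)).card) a ∧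
      (0 < d → 0 ≤ a (d - 1)) := by
  obtain ⟨A, hA⟩ := U.exists_list_mem_iff
  have hcount : ∀ n, ((degLE d n).filter (· ∉ U)).card = countNotAbove d A n := by
    intro n
    rw [countNotAbove]
    congr 1
    apply Finset.filter_congr
    intro α _
    rw [hA]
    simp
  simp only [hcount]
  obtain rfl | hne := eq_or_ne A []
  · refine ⟨fun j => if j = d then 1 else 0, Eventually.of_forall fun n => ?_, fun hd => ?_⟩
    · simp [countNotAbove, card_degLE]
    · dsimp only
      split_ifs <;> simp
  · obtain ⟨a, ha, had⟩ := exists_isNumerical_countNotAbove d _ A rfl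
    refine ⟨a, ha, fun hd => ?_⟩
    obtain ⟨e, rfl⟩ : ∃ e, d = e + 1 := ⟨d - 1, by omega⟩
    rw [if_neg hne] at had
    rw [Nat.add_sub_cancel]
    by_contra! hlt
    have hcoeff : (numericalPoly e a).coeff e < 0 := by
      rw [coeff_numericalPoly]
      exact mul_neg_of_neg_of_pos (by exact_mod_cast hlt) (coeff_binomPoly_pos e)
    have hlc : (numericalPoly e a).leadingCoeff < 0 := by
      rwa [leadingCoeff, natDegree_eq_of_le_of_coeff_ne_zero (natDegree_numericalPoly_le e a)
        hcoeff.ne]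
    refine hlc.not_ge (leadingCoeff_nonneg_of_eventually (ha.mono fun n hn => ?_))
    rw [Finset.sum_range_succ, had, zero_mul, add_zero] at hn
    rw [numericalPoly_eval, ← hn]
    positivity

open Classical in
theorem exists_isNumerical_sum_card_notMem {d : ℕ} (s : List (UpperSet (Fin d → ℕ))) :
    ∃ a, IsNumerical d
      (fun n => ((s.map fun U => ((degLE d n).filter (· ∉ U)).card).sum : ℕ)) a ∧
      (0 < d → 0 ≤ a (d - 1)) := by
  induction s with
  | nil => exact ⟨0, Eventually.of_forall fun n => by simp, by simp⟩
  | cons U s ih =>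
    obtain ⟨a, ha, ha0⟩ := ih
    obtain ⟨b, hb, hb0⟩ := exists_isNumerical_card_notMem U
    refine ⟨b + a, (hb.add ha).mono fun n hn => ?_, fun hd => add_nonneg (hb0 hd) (ha0 hd)⟩
    rw [← hn]
    simp

/-- The Hilbert polynomial of an ideal generated by `d` elements. -/
theorem exists_isHilbertPolynomial_numericalPoly {R : Type*} [CommRing R] [IsLocalRing R]
    {M : Type*} [AddCommGroup M] [Module R M] {d : ℕ} (x : Fin d → R)
    (h : Module.length R (M ⧸ (Ideal.span (Set.range x) • ⊤ : Submodule R M)) ≠ ⊤) :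
    ∃ a, IsHilbertPolynomial (Ideal.span (Set.range x)) M (numericalPoly d a) ∧
      (0 < d → 0 ≤ a (d - 1)) := by
  obtain ⟨s, hs⟩ := exists_upperSets_length x h
  obtain ⟨a, ha, ha0⟩ := exists_isNumerical_sum_card_notMem s
  refine ⟨a, ha.mono fun n hn => ⟨_, hs n, ?_⟩, ha0⟩
  rw [numericalPoly_eval, ← hn, Int.cast_natCast]

end Counting

/-! ### The dimension bounds the degree from below -/

section Dimension

open Filter

variable {R : Type*} [CommRing R] {M N Q : Type*} [AddCommGroup M] [Module R M]
  [AddCommGroup N] [Module R N] [AddCommGroup Q] [Module R Q]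

theorem map_smul_top_le (g : M →ₗ[R] Q) (I : Ideal R) :
    (I • ⊤ : Submodule R M) ≤ (I • ⊤ : Submodule R Q).comap g := by
  rw [← Submodule.map_le_iff_le_comap, Submodule.map_smul'']
  exact smul_mono_right _ le_top

theorem length_quotient_smul_le_of_surjective {g : M →ₗ[R] Q} (hg : Function.Surjective g)
    (I : Ideal R) :
    Module.length R (Q ⧸ (I • ⊤ : Submodule R Q)) ≤
      Module.length R (M ⧸ (I • ⊤ : Submodule R M)) :=
  Module.length_le_of_surjective (Submodule.mapQ _ _ g (map_smul_top_le g I)) <| by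
    intro y
    obtain ⟨y, rfl⟩ := Submodule.mkQ_surjective _ y
    obtain ⟨x, rfl⟩ := hg y
    exact ⟨Submodule.mkQ _ x, rfl⟩

/-- **Artin–Rees** for an injective linear map. -/
theorem exists_comap_pow_smul_top_le [IsNoetherianRing R] [Module.Finite R M] (J : Ideal R)
    {f : N →ₗ[R] M} (hf : Function.Injective f) :
    ∃ k : ℕ, ∀ n, (J ^ (n + k) • ⊤ : Submodule R M).comap f ≤ J ^ n • ⊤ := by
  obtain ⟨k, hk⟩ := Ideal.exists_pow_inf_eq_pow_smul J (LinearMap.range f)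
  refine ⟨k, fun n => ?_⟩
  rw [← Submodule.map_le_map_iff_of_injective hf, Submodule.map_comap_eq, inf_comm,
    hk _ (Nat.le_add_left k n), Nat.add_sub_cancel, Submodule.map_smul'', Submodule.map_top]
  exact smul_mono_right _ inf_le_right

/-- Cut M/IM at the image of N: the upper piece maps onto Q/IQ, and the lower piece is N modulo the
preimage of IM, which maps onto N/KN. -/
theorem length_add_length_le_of_comap_le {f : N →ₗ[R] M} {g : M →ₗ[R] Q}
    (hg : Function.Surjective g) (hfg : ∀ y, g (f y) = 0) {I K : Ideal R}
    (h : (I • ⊤ : Submodule R M).comap f ≤ K • ⊤) :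
    Module.length R (Q ⧸ (I • ⊤ : Submodule R Q)) + Module.length R (N ⧸ (K • ⊤ : Submodule R N)) ≤
      Module.length R (M ⧸ (I • ⊤ : Submodule R M)) := by
  set L : Submodule R M := I • ⊤
  rw [length_quotient_eq_length_quotient_sup_add (le_sup_left : L ≤ L ⊔ LinearMap.range f)]
  apply add_le_add
  · have hle : L ⊔ LinearMap.range f ≤ (I • ⊤ : Submodule R Q).comap g := by
      refine sup_le (map_smul_top_le g I) ?_
      rintro _ ⟨y, rfl⟩
      simp [hfg]
    refine Module.length_le_of_surjective (Submodule.mapQ _ _ g hle) fun y => ?_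
    obtain ⟨y, rfl⟩ := Submodule.mkQ_surjective _ y
    obtain ⟨x, rfl⟩ := hg y
    exact ⟨Submodule.mkQ _ x, rfl⟩
  · have hmap : (L ⊔ LinearMap.range f).map L.mkQ = LinearMap.range (L.mkQ ∘ₗ f) := by
      rw [Submodule.map_sup, LinearMap.range_comp]
      simp
    have hker : LinearMap.ker (L.mkQ ∘ₗ f) = L.comap f := by
      rw [LinearMap.ker_comp, Submodule.ker_mkQ]
    rw [hmap, ← (LinearMap.quotKerEquivRange (L.mkQ ∘ₗ f)).length_eq, hker]
    exact length_quotient_anti h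

variable {J : Ideal R} {P P' : ℚ[X]}

theorem IsHilbertPolynomial.natDegree_le_of_surjective {g : M →ₗ[R] Q}
    (hg : Function.Surjective g) (hP : IsHilbertPolynomial J M P)
    (hP' : IsHilbertPolynomial J Q P') : P'.natDegree ≤ P.natDegree := by
  apply natDegree_le_of_eventually_le
  · filter_upwards [hP'] with n ⟨l, _, hl⟩
    rw [hl]
    positivity
  · filter_upwards [hP, hP'] with n ⟨l, h1, h2⟩ ⟨l', h1', h2'⟩
    have := length_quotient_smul_le_of_surjective hg (J ^ (n + 1))
    rw [h1, h1'] at this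
    rw [h2, h2']
    exact_mod_cast this

/-- If `N` embeds into `M`, with a quotient mapping onto `Q`, then for some `k`,
`P_N(n) + P_Q(n + k) ≤ P_M(n + k)`. -/
theorem IsHilbertPolynomial.exists_eval_add_le [IsNoetherianRing R] [Module.Finite R M]
    {f : N →ₗ[R] M} (hf : Function.Injective f) {g : M →ₗ[R] Q} (hg : Function.Surjective g)
    (hfg : ∀ y, g (f y) = 0) {PM PN PQ : ℚ[X]} (hM : IsHilbertPolynomial J M PM)
    (hN : IsHilbertPolynomial J N PN) (hQ : IsHilbertPolynomial J Q PQ) :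
    ∃ k : ℕ, ∀ᶠ n : ℕ in atTop, PN.eval (n : ℚ) + (taylor (k : ℚ) PQ).eval (n : ℚ) ≤
      (taylor (k : ℚ) PM).eval (n : ℚ) := by
  obtain ⟨k, hk⟩ := exists_comap_pow_smul_top_le J hf
  have htend : Tendsto (· + k) atTop atTop := tendsto_add_atTop_nat k
  refine ⟨k, ?_⟩
  filter_upwards [hN, htend.eventually hM, htend.eventually hQ] with n ⟨a, h1, h2⟩ ⟨b, h3, h4⟩
    ⟨c, h5, h6⟩
  have key := length_add_length_le_of_comap_le hg hfg (hk (n + 1))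
  rw [show n + 1 + k = n + k + 1 by ring, h1, h3, h5] at key
  push_cast at h4 h6
  rw [taylor_eval, taylor_eval, h2, h4, h6, add_comm]
  exact_mod_cast key

theorem IsHilbertPolynomial.natDegree_le_of_injective [IsNoetherianRing R] [Module.Finite R M]
    {f : N →ₗ[R] M} (hf : Function.Injective f) (hM : IsHilbertPolynomial J M P)
    (hN : IsHilbertPolynomial J N P') : P'.natDegree ≤ P.natDegree := by
  -- The general inequality is used with zero quotient.
  have h0 : IsHilbertPolynomial J PUnit (0 : ℚ[X]) :=
    Eventually.of_forall fun n => ⟨0, by simp [Module.length_eq_zero], by simp⟩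
  obtain ⟨k, hk⟩ := IsHilbertPolynomial.exists_eval_add_le (J := J) hf (g := (0 : M →ₗ[R] PUnit))
    (fun y => ⟨0, Subsingleton.elim _ _⟩) (fun y => rfl) hM hN h0
  rw [← natDegree_taylor P (k : ℚ)]
  refine natDegree_le_of_eventually_le ?_ (hk.mono fun n hn => by simpa using hn)
  filter_upwards [hN] with n ⟨l, _, hl⟩
  rw [hl]
  positivity

theorem natDegree_taylor_sub_lt {P : ℚ[X]} {k : ℚ} (h : taylor k P - P ≠ 0) :
    (taylor k P - P).natDegree < P.natDegree := by
  have hP : P ≠ 0 := by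
    rintro rfl
    simp at h
  have hlt := degree_sub_lt_left (degree_taylor P k) (by simpa using hP) (leadingCoeff_taylor k P)
  rw [degree_taylor] at hlt
  exact natDegree_lt_natDegree h hlt

/-- Taking N = M bounds P'(n + k) by P(n + k) - P(n), a difference of smaller degree than P.
Nontriviality makes P' eventually positive, so the difference is not zero. -/
theorem IsHilbertPolynomial.natDegree_lt [IsNoetherianRing R] [Module.Finite R M]
    {f : M →ₗ[R] M} (hf : Function.Injective f) {g : M →ₗ[R] Q} (hg : Function.Surjective g)
    (hfg : ∀ y, g (f y) = 0) (hM : IsHilbertPolynomial J M P) (hQ : IsHilbertPolynomial J Q P')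
    (hpos : ∀ n : ℕ, Nontrivial (Q ⧸ (J ^ (n + 1) • ⊤ : Submodule R Q))) :
    P'.natDegree < P.natDegree := by
  obtain ⟨k, hk⟩ := IsHilbertPolynomial.exists_eval_add_le hf hg hfg hM hM hQ
  have hQpos : ∀ᶠ n : ℕ in atTop, 0 < (taylor (k : ℚ) P').eval (n : ℚ) := by
    have htend : Tendsto (· + k) atTop atTop := tendsto_add_atTop_nat k
    filter_upwards [htend.eventually hQ] with n ⟨l, h1, h2⟩
    push_cast at h2
    rw [taylor_eval, h2]
    have := hpos (n + k)
    have h3 := Module.length_pos (R := R) (M := Q ⧸ (J ^ (n + k + 1) • ⊤ : Submodule R Q))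
    rw [h1] at h3
    exact_mod_cast h3
  have hle : ∀ᶠ n : ℕ in atTop, (taylor (k : ℚ) P').eval (n : ℚ) ≤
      (taylor (k : ℚ) P - P).eval (n : ℚ) :=
    hk.mono fun n hn => by
      rw [eval_sub]
      linarith
  rw [← natDegree_taylor P' (k : ℚ)]
  refine (natDegree_le_of_eventually_le (hQpos.mono fun n => le_of_lt) hle).trans_lt
    (natDegree_taylor_sub_lt fun h => ?_)
  obtain ⟨n, h1, h2⟩ := (hQpos.and hle).exists
  rw [h, eval_zero] at h2
  exact absurd h1 h2.not_gt

variable [IsLocalRing R] {r : ℕ} {x : Fin r → R}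

theorem nontrivial_quotient_pow_smul_top [Module.Finite R M] [Nontrivial M]
    (hJ : J ≤ IsLocalRing.maximalIdeal R) (n : ℕ) :
    Nontrivial (M ⧸ (J ^ (n + 1) • ⊤ : Submodule R M)) := by
  rw [Submodule.Quotient.nontrivial_iff]
  intro h
  refine top_ne_bot (Submodule.eq_bot_of_le_smul_of_le_jacobson_bot (J ^ (n + 1))
    (⊤ : Submodule R M) Module.Finite.fg_top h.ge ?_)
  rw [IsLocalRing.jacobson_eq_maximalIdeal _ bot_ne_top]
  exact (Ideal.pow_le_self n.succ_ne_zero).trans hJ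

/-- Each new prime q at the bottom of the chain raises the degree: some y in the next prime and
outside q acts injectively on R/q, and the next domain is a quotient of R/(q + (y)). -/
theorem length_series_le_natDegree [IsNoetherianRing R]
    (hJ : Ideal.span (Set.range x) ≤ IsLocalRing.maximalIdeal R)
    (p : LTSeries (PrimeSpectrum R)) : ∀ P : ℚ[X],
    Module.length R ((R ⧸ p.head.asIdeal) ⧸
      (Ideal.span (Set.range x) • ⊤ : Submodule R (R ⧸ p.head.asIdeal))) ≠ ⊤ →
    IsHilbertPolynomial (Ideal.span (Set.range x)) (R ⧸ p.head.asIdeal) P →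
    p.length ≤ P.natDegree := by
  induction p using RelSeries.inductionOn with
  | singleton q => simp
  | cons p q hq ih =>
    intro P hfin hP
    rw [RelSeries.head_cons] at hfin hP
    have hq : q.asIdeal < p.head.asIdeal := hq
    obtain ⟨y, hy, hyq⟩ := SetLike.exists_of_lt hq
    have hg := Submodule.factor_surjective hq.le
    have hfin' := ne_top_of_le_ne_top hfin (length_quotient_smul_le_of_surjective hg
      (Ideal.span (Set.range x)))
    obtain ⟨a, ha, -⟩ := exists_isHilbertPolynomial_numericalPoly x hfin'
    have hinj : Function.Injective (LinearMap.lsmul R (R ⧸ q.asIdeal) y) := by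
      rw [← LinearMap.ker_eq_bot, LinearMap.ker_eq_bot']
      intro z hz
      obtain ⟨z, rfl⟩ := Ideal.Quotient.mk_surjective z
      rw [Ideal.Quotient.eq_zero_iff_mem]
      have hz : Ideal.Quotient.mk q.asIdeal (y * z) = 0 := hz
      rw [Ideal.Quotient.eq_zero_iff_mem] at hz
      exact (q.isPrime.mem_or_mem hz).resolve_left hyq
    have hzero : ∀ z, Submodule.factor hq.le (LinearMap.lsmul R (R ⧸ q.asIdeal) y z) = 0 := by
      intro z
      obtain ⟨z, rfl⟩ := Ideal.Quotient.mk_surjective z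
      exact Ideal.Quotient.eq_zero_iff_mem.2 (p.head.asIdeal.mul_mem_right z hy)
    have hlt := IsHilbertPolynomial.natDegree_lt hinj hg hzero hP ha
      (nontrivial_quotient_pow_smul_top hJ)
    have := ih _ hfin' ha
    rw [RelSeries.cons_length]
    omega

/-- The dimension of a module is at most the degree of its Hilbert polynomial. -/
theorem supportDim_le_natDegree [IsNoetherianRing R] [Module.Finite R M]
    (hJ : Ideal.span (Set.range x) ≤ IsLocalRing.maximalIdeal R)
    (hfin : Module.length R (M ⧸ (Ideal.span (Set.range x) • ⊤ : Submodule R M)) ≠ ⊤)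
    (hP : IsHilbertPolynomial (Ideal.span (Set.range x)) M P) :
    Module.supportDim R M ≤ P.natDegree := by
  rw [Module.supportDim, Order.krullDim, iSup_le_iff]
  intro p
  let p' : LTSeries (PrimeSpectrum R) := p.map Subtype.val fun _ _ h => h
  have hhead : Module.annihilator R M ≤ p'.head.asIdeal := by
    have : p'.head ∈ Module.support R M := p.head.2
    rwa [Module.support_eq_zeroLocus] at this
  have := p'.head.isPrime
  -- A minimal prime q of the annihilator below the chain is associated, so R/q embeds in M and maps
  -- onto the domain at the head of the chain.
  obtain ⟨q, hq, hqle⟩ := Ideal.exists_minimalPrimes_le hhead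
  have hass := Module.associatedPrimes.minimalPrimes_annihilator_subset_associatedPrimes R M hq
  obtain ⟨-, f, hf⟩ := (isAssociatedPrime_iff_exists_injective_linearMap q M).1 hass
  obtain ⟨k, hk⟩ := exists_comap_pow_smul_top_le (Ideal.span (Set.range x)) hf
  obtain ⟨s, hs⟩ := exists_upperSets_length x hfin
  have hfinq : Module.length R ((R ⧸ q) ⧸
      (Ideal.span (Set.range x) • ⊤ : Submodule R (R ⧸ q))) ≠ ⊤ := by
    -- Artin–Rees makes (R/q)/J(R/q) a subquotient of M/J^{k+1}M, which has finite length.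
    have key := length_add_length_le_of_comap_le (g := (0 : M →ₗ[R] PUnit))
      (fun y => ⟨0, Subsingleton.elim _ _⟩) (fun y => rfl) (hk 1)
    rw [pow_one, add_comm 1 k, hs] at key
    exact ne_top_of_le_ne_top (ENat.natCast_ne_top _) (le_add_self.trans key)
  obtain ⟨a, ha, -⟩ := exists_isHilbertPolynomial_numericalPoly x hfinq
  have hg := Submodule.factor_surjective hqle
  have hfin' := ne_top_of_le_ne_top hfinq (length_quotient_smul_le_of_surjective hg
    (Ideal.span (Set.range x)))
  obtain ⟨b, hb, -⟩ := exists_isHilbertPolynomial_numericalPoly x hfin'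
  have h1 := length_series_le_natDegree hJ p' _ hfin' hb
  have h2 := ha.natDegree_le_of_surjective hg hb
  have h3 := hP.natDegree_le_of_injective hf ha
  exact_mod_cast h1.trans (h2.trans h3)

end Dimension

/-! ### Hilbert coefficients and the sign of the Chern number -/

section HilbertCoefficients

/-- Reversing the order of summation identifies e_i with (-1)^i a_{d-i}; the degree hypothesis
matters because `IsHilbertCoeffs` indexes from `natDegree`. -/
theorem isHilbertCoeffs_numericalPoly {d : ℕ} {a : ℕ → ℤ} (h : (numericalPoly d a).natDegree = d) :
    IsHilbertCoeffs (numericalPoly d a) fun i => if i ≤ d then (-1) ^ i * a (d - i) else 0 := by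
  refine ⟨?_, fun i hi => if_neg (by omega)⟩
  rw [h]
  conv_lhs => rw [numericalPoly, ← Finset.sum_range_reflect]
  refine Finset.sum_congr rfl fun i hi => ?_
  have hi : i ≤ d := Nat.le_of_lt_succ (Finset.mem_range.1 hi)
  have hsq : (-1 : ℚ) ^ i * (-1) ^ i = 1 := by rw [← mul_pow]; simp
  dsimp only
  rw [if_pos hi, Nat.add_sub_cancel]
  push_cast
  rw [← mul_assoc, hsq, one_mul]

end HilbertCoefficients

theorem mainTheorem3 {R : Type*} [CommRing R] [IsLocalRing R] [IsNoetherianRing R]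
    {M : Type*} [AddCommGroup M] [Module R M] [Module.Finite R M]
    {d : ℕ} (hdim : Module.supportDim R M = d)
    (x : Fin d → R) (hx : IsSystemOfParameters R M x)
    (J : Ideal R) (hJ : J = Ideal.span (Set.range x)) :
    IsHilbertPolynomial J M (hilbertPolynomial J M) ∧
    (hilbertPolynomial J M).natDegree = d ∧
    IsHilbertCoeffs (hilbertPolynomial J M) (hilbertCoeff (hilbertPolynomial J M)) ∧
    chernNumber J M ≤ 0 := by
  subst hJ
  obtain ⟨a, ha, ha0⟩ := exists_isHilbertPolynomial_numericalPoly x hx.length_ne_top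
  have hH := Classical.epsilon_spec (p := fun P => IsHilbertPolynomial (Ideal.span (Set.range x)) M P)
    ⟨_, ha⟩
  have hPa : hilbertPolynomial (Ideal.span (Set.range x)) M = numericalPoly d a := hH.unique ha
  have hJ : Ideal.span (Set.range x) ≤ IsLocalRing.maximalIdeal R := by
    rw [Ideal.span_le]
    rintro _ ⟨i, rfl⟩
    exact hx.mem_maximalIdeal i
  have hdeg : (numericalPoly d a).natDegree = d := by
    refine (natDegree_numericalPoly_le d a).antisymm ?_
    have := supportDim_le_natDegree hJ hx.length_ne_top ha
    rw [hdim] at this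
    exact_mod_cast this
  have hc := isHilbertCoeffs_numericalPoly hdeg
  have hspec : IsHilbertCoeffs (numericalPoly d a) (hilbertCoeff (numericalPoly d a)) :=
    Classical.epsilon_spec (p := fun e : ℕ → ℤ => IsHilbertCoeffs (numericalPoly d a) e) ⟨_, hc⟩
  rw [chernNumber, hPa]
  refine ⟨ha, hdeg, hspec, ?_⟩
  rw [hspec.unique hc]
  dsimp only
  -- For d ≥ 1 the value is -a_{d-1}; for d = 0 it is zero by convention.
  split_ifs with h
  · simpa using ha0 h
  · exact le_rfl
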